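/- Let $\pi$ be a probability distribution on a measurable space $\mathsf X$ (for instance $\mathsf X\subseteq\mathbb R^d$), let $p_1,p_2$ be nonnegative integers, let $g:\mathsf X\to\mathbb R^{p_1}$ and $h=(h_1,\dots,h_{p_2}):\mathsf X\to\mathbb R^{p_2}$ be measurable, and let $q_1,\dots,q_{p_2}\in(0,1)$. For $X\sim\pi$ write $F_{h_i}$ for the distribution function of $h_i(X)$, $\xi_{q_i}=\inf\{v: F_{h_i}(v)\ge q_i\}$, $\phi_h=(\xi_{q_1},\dots,\xi_{q_{p_2}})'$ and $\theta_g=E_\pi g(X)$. Let $X_1,X_2,\dots$ be IID with distribution $\pi$, and put $\bar g_n=\frac1n\sum_{j=1}^n g(X_j)$ and $\hat\phi_n=(\hat\xi_{q_1},\dots,\hat\xi_{q_{p_2}})'$, where $\hat\xi_{q_i}$ is the $\lceil nq_i\rceil$-th order statistic (the $\lceil nq_i\rceil$-th smallest value) of $h_i(X_1),\dots,h_i(X_n)$. Suppose that $E_\pi\|g(X)\|^2<\infty$ and that, for every $i$, $F_{h_i}$ is absolutely continuous with a density $f_{h_i}:\mathbb R\to[0,\infty)$ such that $0<f_{h_i}(\xi_{q_i})<\infty$,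 and $f_{h_i}$ is differentiable with bounded derivative $f_{h_i}'$ in a neighborhood of $\xi_{q_i}$. Let $$\Lambda=\begin{pmatrix} I_{p_1} & 0\\ 0 & A_h\end{pmatrix},\qquad A_h=\operatorname{diag}\bigl(f_{h_1}(\xi_{q_1}),\dots,f_{h_{p_2}}(\xi_{q_{p_2}})\bigr),$$ $$Y_1=\bigl(g(X_1)',\,I(h_1(X_1)>\xi_{q_1}),\dots,I(h_{p_2}(X_1)>\xi_{q_{p_2}})\bigr)',\qquad \Sigma=\operatorname{Var}_\pi(Y_1).$$ Then, as $n\to\infty$, $$\sqrt n\begin{pmatrix}\bar g_n-\theta_g\\ \hat\phi_n-\phi_h\end{pmatrix}\overset{d}{\longrightarrow} N\bigl(0,\Lambda^{-1}\Sigma\Lambda^{-1}\bigr),$$ where the normal distribution may be degenerate if $\Sigma$ is singular. -/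

import Mathlib

open MeasureTheory ProbabilityTheory Filter Topology

noncomputable section

namespace MeanQuantile

/-- The `q`-quantile `F⁻¹(q) = inf {v : F(v) ≥ q}` of a probability distribution `μ` on `ℝ`,
where `F` is the distribution function of `μ`. -/
def quantile (μ : Measure ℝ) (q : ℝ) : ℝ :=
  sInf {v : ℝ | q ≤ cdf μ v}

/-- The order statistics of a finite sample `x`, indexed from zero: `orderStatistic x k` is the
`(k + 1)`-st smallest of the values `x 0, …, x (n - 1)`, counted with multiplicity. -/
def orderStatistic {n : ℕ} (x : Fin n → ℝ) (k : Fin n) : ℝ :=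
  x (Tuple.sort x k)

/-- The sample `q`-quantile: the `⌈n q⌉`-th order statistic `x_{⌈n q⌉ : n}` of the sample
`x` of size `n`. (For `0 < q < 1` and `1 ≤ n` one has `1 ≤ ⌈n q⌉ ≤ n`, and the default value `0`
is never used.) -/
def sampleQuantile (q : ℝ) {n : ℕ} (x : Fin n → ℝ) : ℝ :=
  if hk : ⌈(n : ℝ) * q⌉₊ - 1 < n then orderStatistic x ⟨⌈(n : ℝ) * q⌉₊ - 1, hk⟩ else 0

/-- The covariance matrix `Var_μ(Y)` of a random vector `Y`. -/
def varMatrix {S ι : Type*} [MeasurableSpace S] (μ : Measure S)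
    (Y : S → EuclideanSpace ℝ ι) : Matrix ι ι ℝ :=
  Matrix.of fun a b => cov[fun s => Y s a, fun s => Y s b; μ]

section

variable {S : Type*} [MeasurableSpace S] {p₁ p₂ : ℕ}

/-- The vector `φ_h = (ξ_{q_1}, …, ξ_{q_{p₂}})`: its `i`-th entry is the `q i`-quantile of the
distribution of `h_i(X)`, `X ∼ π`. -/
def quantileVec (π : Measure S) (h : S → EuclideanSpace ℝ (Fin p₂)) (q : Fin p₂ → ℝ) :
    EuclideanSpace ℝ (Fin p₂) :=
  WithLp.toLp 2 fun i => quantile (π.map fun x => h x i) (q i)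

/-- The vector of features `ν = (θ_g, φ_h)`, where `θ_g = E_π g`. -/
def features (π : Measure S) (g : S → EuclideanSpace ℝ (Fin p₁))
    (h : S → EuclideanSpace ℝ (Fin p₂)) (q : Fin p₂ → ℝ) :
    EuclideanSpace ℝ (Fin p₁ ⊕ Fin p₂) :=
  WithLp.toLp 2 (Sum.elim (fun i => ∫ x, g x i ∂π) (fun i => quantileVec π h q i))

/-- The estimator `ν̂_n = (ḡ_n, φ̂_n)` of the features computed from a sample `x` of size `n`:
sample means of the `g_i`, and sample quantiles of the `h_i`. -/
def featuresEstimator (g : S → EuclideanSpace ℝ (Fin p₁))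
    (h : S → EuclideanSpace ℝ (Fin p₂)) (q : Fin p₂ → ℝ) {n : ℕ} (x : Fin n → S) :
    EuclideanSpace ℝ (Fin p₁ ⊕ Fin p₂) :=
  WithLp.toLp 2 (Sum.elim
    (fun i => (n : ℝ)⁻¹ * ∑ j : Fin n, g (x j) i)
    (fun i => sampleQuantile (q i) fun j : Fin n => h (x j) i))

/-- The vector `(g(x), I(h(x) > φ))`, with the indicator taken coordinatewise. -/
def scoreVec (g : S → EuclideanSpace ℝ (Fin p₁)) (h : S → EuclideanSpace ℝ (Fin p₂))
    (φ : EuclideanSpace ℝ (Fin p₂)) (x : S) : EuclideanSpace ℝ (Fin p₁ ⊕ Fin p₂) :=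
  WithLp.toLp 2 (Sum.elim (fun i => g x i)
    (fun i => Set.indicator (Set.Ioi (φ i)) (fun _ => (1 : ℝ)) (h x i)))

end

/-- The block diagonal matrix `Λ = diag(I_{p₁}, A_h)`, where `A_h` is diagonal with diagonal
entries `f_i(φ_i)`. -/
def lambdaMatrix (p₁ : ℕ) {p₂ : ℕ} (f : Fin p₂ → ℝ → ℝ) (φ : EuclideanSpace ℝ (Fin p₂)) :
    Matrix (Fin p₁ ⊕ Fin p₂) (Fin p₁ ⊕ Fin p₂) ℝ :=
  Matrix.fromBlocks 1 0 0 (Matrix.diagonal fun i => f i (φ i))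

end MeanQuantile

end

open MeanQuantile

/-! Up to an error vanishing in probability, the whole normalized vector is one centered IID sum, so
the multivariate CLT and Slutsky's theorem finish the proof. For the means this is exact. For a
quantile with density value `d` at `ξ`, it is the Bahadur–Ghosh representation
(`tendstoInMeasure_sampleQuantile_sub_scaledSum`): `√n (ξ̂ - ξ)` is asymptotically the scaled sum of
`d⁻¹ I(h > ξ)`.

Its source is a duality: a sample quantile is at most `v` iff at least `nq` observations are. At `v
= ξ + y/√n` the event `√n (ξ̂ - ξ) ≤ y` becomes `Z ≤ u`, with `Z` an indicator sum at the moving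
threshold `v` and `u → y` by differentiability of the distribution function. Moving the threshold
back to `ξ` costs `o_P(1)` by Chebyshev, and Ghosh's comparison lemma turns agreement of events into
agreement of variables. -/

namespace MeanQuantile

/-! ### Order statistics, counts and quantiles -/

lemma orderStatistic_le_iff {n : ℕ} (x : Fin n → ℝ) (k : Fin n) (v : ℝ) :
    orderStatistic x k ≤ v ↔ (k : ℕ) < (Finset.univ.filter fun j => x j ≤ v).card := by
  have h := Tuple.lt_card_le_iff_apply_le_of_monotone (j := k) (a := v) (Tuple.monotone_sort x)
  have hc : (Finset.univ.filter fun i => (x ∘ Tuple.sort x) i ≤ v).card =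
      (Finset.univ.filter fun j => x j ≤ v).card :=
    Finset.card_equiv (Tuple.sort x) (by simp)
  rw [hc] at h
  exact h.symm

lemma sampleQuantile_le_iff {q : ℝ} (hq0 : 0 < q) (hq1 : q < 1) {n : ℕ} (hn : 0 < n)
    (x : Fin n → ℝ) (v : ℝ) :
    sampleQuantile q x ≤ v ↔ (n : ℝ) * q ≤ ((Finset.univ.filter fun j => x j ≤ v).card : ℝ) := by
  have hn' : (0 : ℝ) < n := by exact_mod_cast hn
  -- Since `⌈nq⌉` lies between `1` and `n`, the default value is avoided and the truncated
  -- subtraction of `1` is exact.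
  have h1 : ⌈(n : ℝ) * q⌉₊ ≤ n := Nat.ceil_le.2 (by nlinarith)
  have h0 : 0 < ⌈(n : ℝ) * q⌉₊ := Nat.ceil_pos.2 (by positivity)
  have hk : ⌈(n : ℝ) * q⌉₊ - 1 < n := by omega
  rw [sampleQuantile, dif_pos hk, orderStatistic_le_iff, ← Nat.ceil_le]
  simp only
  omega

lemma measurable_sampleQuantile {Ω : Type*} [MeasurableSpace Ω] {q : ℝ} (hq0 : 0 < q)
    (hq1 : q < 1) {n : ℕ} (x : Ω → Fin n → ℝ) (hx : ∀ j, Measurable fun ω => x ω j) :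
    Measurable fun ω => sampleQuantile q (x ω) := by
  rcases Nat.eq_zero_or_pos n with rfl | hn
  · simp [sampleQuantile]
  refine measurable_of_Iic fun v => ?_
  have : (fun ω => sampleQuantile q (x ω)) ⁻¹' Set.Iic v =
      {ω | (n : ℝ) * q ≤ ∑ j, Set.indicator (Set.Iic v) (fun _ => (1 : ℝ)) (x ω j)} := by
    ext ω
    simp [sampleQuantile_le_iff hq0 hq1 hn, Set.indicator_apply]
  rw [this]
  refine measurableSet_le measurable_const (Finset.measurable_sum _ fun j _ => ?_)
  exact (measurable_const.indicator measurableSet_Iic).comp (hx j)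

/-- Left of the infimum `F < q`, right of it `F ≥ q` by monotonicity; continuity forces equality. -/
lemma cdf_quantile {μ : Measure ℝ} {q : ℝ} (hq0 : 0 < q) (hq1 : q < 1)
    (hc : ContinuousAt (cdf μ) (quantile μ q)) : cdf μ (quantile μ q) = q := by
  obtain ⟨b, hb⟩ := ((tendsto_cdf_atTop μ).eventually (eventually_ge_nhds hq1)).exists
  obtain ⟨a, ha⟩ := ((tendsto_cdf_atBot μ).eventually (eventually_lt_nhds hq0)).exists
  have hne : {v : ℝ | q ≤ cdf μ v}.Nonempty := ⟨b, hb⟩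
  have hbdd : BddBelow {v : ℝ | q ≤ cdf μ v} := by
    refine ⟨a, fun v hv => ?_⟩
    by_contra! hlt
    exact absurd (monotone_cdf μ hlt.le) (not_le.2 (ha.trans_le hv))
  apply le_antisymm
  · refine le_of_tendsto (hc.tendsto.mono_left (nhdsWithin_le_nhds (s := Set.Iio (quantile μ q)))) ?_
    filter_upwards [self_mem_nhdsWithin] with v hv
    by_contra! hlt
    exact absurd (csInf_le hbdd hlt.le) (not_le.2 hv)
  · refine ge_of_tendsto (hc.tendsto.mono_left (nhdsWithin_le_nhds (s := Set.Ioi (quantile μ q)))) ?_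
    filter_upwards [self_mem_nhdsWithin] with v hv
    obtain ⟨w, hw, hwv⟩ := (csInf_lt_iff hbdd hne).1 (show sInf _ < v from hv)
    exact hw.trans (monotone_cdf μ hwv.le)

/-! ### Differentiating the distribution function -/

section density

variable {μ : Measure ℝ} [IsProbabilityMeasure μ] {f : ℝ → ℝ}

lemma integrable_of_withDensity (hf : Measurable f) (hf0 : ∀ v, 0 ≤ f v)
    (hμ : μ = volume.withDensity fun v => ENNReal.ofReal (f v)) : Integrable f := by
  refine ⟨hf.aestronglyMeasurable, ?_⟩
  rw [hasFiniteIntegral_iff_ofReal (ae_of_all _ hf0)]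
  have h := measure_lt_top μ Set.univ
  rwa [hμ, withDensity_apply _ MeasurableSet.univ, Measure.restrict_univ] at h

lemma cdf_eq_integral_density (hf : Measurable f) (hf0 : ∀ v, 0 ≤ f v)
    (hμ : μ = volume.withDensity fun v => ENNReal.ofReal (f v)) (v : ℝ) :
    cdf μ v = ∫ x in Set.Iic v, f x := by
  rw [cdf_eq_real, Measure.real, hμ, withDensity_apply _ measurableSet_Iic,
    integral_eq_lintegral_of_nonneg_ae (ae_of_all _ hf0) hf.aestronglyMeasurable]

lemma hasDerivAt_cdf (hf : Measurable f) (hf0 : ∀ v, 0 ≤ f v)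
    (hμ : μ = volume.withDensity fun v => ENNReal.ofReal (f v)) {ξ : ℝ}
    (hc : ContinuousAt f ξ) : HasDerivAt (cdf μ) (f ξ) ξ := by
  have hint := integrable_of_withDensity hf hf0 hμ
  have h := intervalIntegral.integral_hasDerivAt_right (a := ξ)
    (hint.intervalIntegrable) (hf.stronglyMeasurable.stronglyMeasurableAtFilter) hc
  have he : (cdf μ : ℝ → ℝ) = fun v => cdf μ ξ + ∫ x in ξ..v, f x := by
    ext v
    rw [cdf_eq_integral_density hf hf0 hμ, cdf_eq_integral_density hf hf0 hμ,
      ← intervalIntegral.integral_Iic_sub_Iic hint.integrableOn hint.integrableOn]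
    ring
  rw [he]
  exact h.const_add _

end density

/-! ### From asymptotically equal events to asymptotically equal variables -/

section comparison

variable {Ω : Type*} [MeasurableSpace Ω] {P : Measure Ω} [IsProbabilityMeasure P]

/-- Ghosh's comparison lemma: if `W` is tight and the event `V n ≤ y` is asymptotically the event
`W n ≤ y`, for every `y`, then `V n - W n` tends to zero in probability. -/
lemma tendstoInMeasure_sub_of_forall_le_iff {V W : ℕ → Ω → ℝ}
    (hW : ∀ δ > 0, ∃ M, ∀ n, P.real {ω | M ≤ |W n ω|} ≤ δ)
    (hVW : ∀ y, ∃ (Z : ℕ → Ω → ℝ) (u : ℕ → ℝ), Tendsto u atTop (𝓝 y) ∧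
      (∀ᶠ n in atTop, ∀ ω, V n ω ≤ y ↔ Z n ω ≤ u n) ∧
      TendstoInMeasure P (fun n => W n - Z n) atTop 0) :
    TendstoInMeasure P (fun n => V n - W n) atTop 0 := by
  choose Z u hu hiff hZ using hVW
  rw [tendstoInMeasure_iff_measureReal_norm]
  intro ε hε
  simp only [Pi.sub_apply, Pi.zero_apply, sub_zero, Real.norm_eq_abs]
  obtain ⟨η, hη, rfl⟩ : ∃ η > 0, ε = 3 * η := ⟨ε / 3, by positivity, by ring⟩
  rw [Metric.tendsto_nhds]
  intro δ hδ
  obtain ⟨M, hM⟩ := hW (δ / 2) (by positivity)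
  -- The grid of mesh `η` on `[-Kη, Kη]` reaches far enough to contain the points chosen below
  -- whenever `|W| < M`.
  obtain ⟨K, hK⟩ := exists_int_gt (|M| / η + 3)
  have hsum : Tendsto (fun n => ∑ k ∈ Finset.Icc (-K) K,
      P.real {ω | η / 2 ≤ |W n ω - Z (k * η) n ω|}) atTop (𝓝 0) := by
    refine Finset.sum_const_zero (ι := ℤ) (M := ℝ) (s := Finset.Icc (-K) K) ▸
      tendsto_finsetSum _ fun k _ => ?_
    have h := tendstoInMeasure_iff_measureReal_norm.1 (hZ (k * η)) (η / 2) (by positivity)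
    simpa using h
  have hev : ∀ᶠ n in atTop, ∀ k ∈ Finset.Icc (-K) K,
      |u (k * η) n - k * η| < η / 2 ∧ ∀ ω, V n ω ≤ k * η ↔ Z (k * η) n ω ≤ u (k * η) n := by
    rw [Filter.eventually_all_finset]
    intro k _
    refine Filter.Eventually.and ?_ (hiff _)
    simpa [Real.dist_eq] using Metric.tendsto_nhds.1 (hu (k * η)) (η / 2) (by positivity)
  filter_upwards [hev, hsum.eventually_lt_const (half_pos hδ)] with n hn hlt
  rw [Real.dist_eq, sub_zero, abs_of_nonneg measureReal_nonneg]
  have hsub : {ω | 3 * η ≤ |V n ω - W n ω|} ⊆ {ω | M ≤ |W n ω|} ∪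
      ⋃ k ∈ Finset.Icc (-K) K, {ω | η / 2 ≤ |W n ω - Z (k * η) n ω|} := by
    intro ω hω
    simp only [Set.mem_ofPred_eq] at hω
    rcases le_or_gt M |W n ω| with hMW | hMW
    · exact Or.inl hMW
    refine Or.inr ?_
    have hW' := abs_lt.1 (hMW.trans_le (le_abs_self M))
    have hKη : |M| + 3 * η < K * η := by
      have := mul_lt_mul_of_pos_right hK hη
      rwa [add_mul, div_mul_cancel₀ _ hη.ne'] at this
    have hmem : ∀ k : ℤ, -(K : ℝ) * η ≤ k * η → (k : ℝ) * η ≤ K * η → k ∈ Finset.Icc (-K) K := by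
      intro k h1 h2
      have h1' := le_of_mul_le_mul_right h1 hη
      have h2' := le_of_mul_le_mul_right h2 hη
      exact Finset.mem_Icc.2 ⟨by exact_mod_cast h1', by exact_mod_cast h2'⟩
    simp only [Set.mem_iUnion, Set.mem_ofPred_eq, exists_prop]
    have hfl : ∀ x : ℝ, (⌊x / η⌋ : ℝ) * η ≤ x ∧ x < ⌊x / η⌋ * η + η := by
      intro x
      have h1 := mul_le_mul_of_nonneg_right (Int.floor_le (x / η)) hη.le
      have h2 := mul_lt_mul_of_pos_right (Int.lt_floor_add_one (x / η)) hη
      rw [div_mul_cancel₀ _ hη.ne'] at h1 h2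
      exact ⟨h1, by linarith⟩
    -- A gap of `3η` leaves room for a grid point strictly between `V` and `W`, more than `η` away
    -- from `W` or exactly `η`. There `V` and `Z` fall on the same side, and `u` is within `η/2`, so
    -- `Z` is at least `η/2` from `W`.
    rcases le_abs.1 hω with h | h
    · obtain ⟨h1, h2⟩ := hfl (W n ω + 2 * η)
      have hk := hmem ⌊(W n ω + 2 * η) / η⌋ (by linarith) (by linarith)
      refine ⟨_, hk, ?_⟩
      obtain ⟨hk1, hk2⟩ := hn _ hk
      have h3 := (hk2 ω).not.1 (by linarith)
      have h4 := abs_lt.1 hk1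
      rw [le_abs]
      right; linarith
    · obtain ⟨h1, h2⟩ := hfl (W n ω - η)
      have hk := hmem ⌊(W n ω - η) / η⌋ (by linarith) (by linarith)
      refine ⟨_, hk, ?_⟩
      obtain ⟨hk1, hk2⟩ := hn _ hk
      have h3 := (hk2 ω).1 (by linarith)
      have h4 := abs_lt.1 hk1
      rw [le_abs]
      left; linarith
  calc P.real {ω | 3 * η ≤ |V n ω - W n ω|}
      ≤ P.real {ω | M ≤ |W n ω|} + P.real (⋃ k ∈ Finset.Icc (-K) K,
          {ω | η / 2 ≤ |W n ω - Z (k * η) n ω|}) :=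
        (measureReal_mono hsub).trans (measureReal_union_le _ _)
    _ ≤ δ / 2 + ∑ k ∈ Finset.Icc (-K) K, P.real {ω | η / 2 ≤ |W n ω - Z (k * η) n ω|} :=
        add_le_add (hM n) (measureReal_biUnion_finset_le _ _)
    _ < δ := by linarith

end comparison

/-! ### Normalized sums and Chebyshev's inequality -/

section scaledSum

variable {S Ω : Type*} [MeasurableSpace S]

/-- The centered sum `n^{-1/2} ∑_{j < n} (φ(X_j) - E_π φ)`. -/
noncomputable def scaledSum (π : Measure S) (X : ℕ → Ω → S) (φ : S → ℝ) (n : ℕ) (ω : Ω) : ℝ :=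
  (√(n : ℝ))⁻¹ * ∑ j ∈ Finset.range n, (φ (X j ω) - ∫ s, φ s ∂π)

variable {π : Measure S} {X : ℕ → Ω → S}

lemma scaledSum_sub {φ ψ : S → ℝ} (hφ : Integrable φ π) (hψ : Integrable ψ π) (n : ℕ) (ω : Ω) :
    scaledSum π X (fun s => φ s - ψ s) n ω = scaledSum π X φ n ω - scaledSum π X ψ n ω := by
  simp only [scaledSum]
  rw [← mul_sub, ← Finset.sum_sub_distrib, integral_sub hφ hψ]
  congr 1
  exact Finset.sum_congr rfl fun j _ => by ring

variable [MeasurableSpace Ω] {P : Measure Ω}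

lemma measurable_scaledSum (hX : ∀ n, Measurable (X n)) {φ : S → ℝ} (hφ : Measurable φ) (n : ℕ) :
    Measurable (scaledSum π X φ n) := by
  unfold scaledSum
  refine (Finset.measurable_sum _ fun j _ => ?_).const_mul _
  exact (hφ.comp (hX j)).sub_const _

variable [IsProbabilityMeasure π] [IsProbabilityMeasure P]

/-- Chebyshev with a bound uniform in `n`, as the scaling cancels the growth of the variance. It
yields both tightness and the negligibility of threshold shifts. -/
lemma measureReal_le_abs_scaledSum_le (hX : ∀ n, Measurable (X n)) (hX_indep : iIndepFun X P)
    (hX_law : ∀ n, P.map (X n) = π) {φ : S → ℝ} (hφ : Measurable φ) (hφ2 : MemLp φ 2 π)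
    {c : ℝ} (hc : 0 < c) (n : ℕ) :
    P.real {ω | c ≤ |scaledSum π X φ n ω|} ≤ (∫ s, φ s ^ 2 ∂π) / c ^ 2 := by
  rcases Nat.eq_zero_or_pos n with rfl | hn
  · simp only [scaledSum, Finset.range_zero, Finset.sum_empty, mul_zero, abs_zero, not_le.2 hc,
      Set.ofPred_false, measureReal_empty]
    exact div_nonneg (integral_nonneg fun s => sq_nonneg _) (sq_nonneg _)
  have hmem (j : ℕ) : MemLp (φ ∘ X j) 2 P := by
    refine MemLp.comp_measurePreserving hφ2 ⟨hX j, hX_law j⟩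
  have hint (j : ℕ) : ∫ ω, φ (X j ω) ∂P = ∫ s, φ s ∂π := by
    rw [← hX_law j, integral_map (hX j).aemeasurable hφ.aestronglyMeasurable]
  have hvar (j : ℕ) : variance (φ ∘ X j) P = variance φ π := by
    rw [← hX_law j, variance_map hφ.aemeasurable (hX j).aemeasurable]
  have hmemT : MemLp (∑ j ∈ Finset.range n, φ ∘ X j) 2 P := memLp_finsetSum' _ fun j _ => hmem j
  have hT : variance (∑ j ∈ Finset.range n, φ ∘ X j) P = n * variance φ π := by
    rw [IndepFun.variance_sum (fun j _ => hmem j)]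
    · simp [hvar]
    · intro i _ j _ hij
      exact (hX_indep.indepFun hij).comp hφ hφ
  have hs : 0 < √(n : ℝ) := Real.sqrt_pos.2 (by exact_mod_cast hn)
  have hset : {ω | c ≤ |scaledSum π X φ n ω|} = {ω | c * √(n : ℝ) ≤
      |(∑ j ∈ Finset.range n, φ ∘ X j) ω - P[∑ j ∈ Finset.range n, φ ∘ X j]|} := by
    ext ω
    have hE : P[∑ j ∈ Finset.range n, φ ∘ X j] = n * ∫ s, φ s ∂π := by
      simp only [Finset.sum_apply]
      rw [integral_finsetSum _ fun j _ => ((hmem j).integrable one_le_two)]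
      simp [hint]
    rw [Set.mem_ofPred_eq, Set.mem_ofPred_eq, hE, scaledSum, abs_mul, abs_of_pos (inv_pos.2 hs),
      inv_mul_eq_div, le_div_iff₀ hs]
    simp
  have h := meas_ge_le_variance_div_sq hmemT (mul_pos hc hs)
  rw [← hset, hT, mul_pow, Real.sq_sqrt (Nat.cast_nonneg n)] at h
  have hn' : (0 : ℝ) < n := by exact_mod_cast hn
  have h2 : P.real {ω | c ≤ |scaledSum π X φ n ω|} ≤ n * variance φ π / (c ^ 2 * n) :=
    ENNReal.toReal_le_of_le_ofReal (by have := variance_nonneg φ π; positivity) h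
  refine h2.trans ?_
  rw [mul_comm (c ^ 2), mul_div_mul_left _ _ hn'.ne']
  gcongr
  exact variance_le_expectation_sq hφ.aestronglyMeasurable

end scaledSum

end MeanQuantile

namespace MeanQuantile

/-! ### The multivariate central limit theorem -/

section centralLimit

variable {S Ω : Type*} [MeasurableSpace S] {π : Measure S} {X : ℕ → Ω → S} {ι : Type*} [Fintype ι]
  {Y : S → EuclideanSpace ℝ ι}

lemma sum_mul_scaledSum (hY : ∀ a, Integrable (fun s => Y s a) π) (t : ι → ℝ) (n : ℕ) (ω : Ω) :
    ∑ a, t a * scaledSum π X (fun s => Y s a) n ω =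
      scaledSum π X (fun s => ∑ a, t a * Y s a) n ω := by
  simp only [scaledSum]
  rw [integral_finsetSum _ fun a _ => (hY a).const_mul (t a)]
  simp only [integral_const_mul, ← Finset.sum_sub_distrib, ← mul_sub]
  rw [Finset.sum_comm, Finset.mul_sum]
  refine Finset.sum_congr rfl fun a _ => ?_
  rw [← Finset.mul_sum]
  ring

variable [MeasurableSpace Ω] {P : Measure Ω} [IsProbabilityMeasure P]

lemma tendstoInDistribution_scaledSum_real (hX : ∀ n, Measurable (X n))
    (hX_indep : iIndepFun X P) (hX_law : ∀ n, P.map (X n) = π) {φ : S → ℝ} (hφ : Measurable φ)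
    (hφ2 : MemLp φ 2 π) :
    TendstoInDistribution (fun n ω => scaledSum π X φ n ω) atTop (id : ℝ → ℝ) (fun _ => P)
      (gaussianReal 0 (variance φ π).toNNReal) := by
  have hvar : variance (fun ω => φ (X 0 ω)) P = variance φ π := by
    rw [← hX_law 0, variance_map hφ.aemeasurable (hX 0).aemeasurable]; rfl
  have hint : ∫ ω, φ (X 0 ω) ∂P = ∫ s, φ s ∂π := by
    rw [← hX_law 0, integral_map (hX 0).aemeasurable hφ.aestronglyMeasurable]
  have h := tendstoInDistribution_inv_sqrt_mul_sum_sub (P := P)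
    (P' := gaussianReal 0 (variance φ π).toNNReal) (X := fun n ω => φ (X n ω)) (Y := id)
    ⟨aemeasurable_id, by rw [hvar, Measure.map_id]⟩
    (hφ2.comp_measurePreserving ⟨hX 0, hX_law 0⟩)
    (hX_indep.comp (fun _ => φ) fun _ => hφ)
    (fun i => IdentDistrib.comp
      ⟨(hX i).aemeasurable, (hX 0).aemeasurable, by rw [hX_law, hX_law]⟩ hφ)
  convert h using 3 with n ω
  simp [scaledSum, hint]

variable [IsProbabilityMeasure π]

lemma variance_sum_mul (hY2 : ∀ a, MemLp (fun s => Y s a) 2 π) (t : ι → ℝ) :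
    variance (fun s => ∑ a, t a * Y s a) π = t ⬝ᵥ (varMatrix π Y).mulVec t := by
  rw [variance_fun_sum fun a => (hY2 a).const_mul (t a)]
  simp only [dotProduct, Matrix.mulVec, varMatrix, Matrix.of_apply, Finset.mul_sum,
    covariance_const_mul_left, covariance_const_mul_right]
  exact Finset.sum_congr rfl fun a _ => Finset.sum_congr rfl fun b _ => by ring

lemma posSemidef_varMatrix (hY2 : ∀ a, MemLp (fun s => Y s a) 2 π) :
    (varMatrix π Y).PosSemidef := by
  refine Matrix.PosSemidef.of_dotProduct_mulVec_nonneg ?_ fun t => ?_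
  · ext a b
    simp [varMatrix, covariance_comm]
  · rw [star_trivial, ← variance_sum_mul hY2]
    exact variance_nonneg _ _

/-- Cramér–Wold: the characteristic function at `t` is that of the scalar sum for `⟨t, Y⟩` at `1`,
whose limiting variance is `tᵀΣt`. Only semidefiniteness of `Σ` is needed. -/
lemma tendstoInDistribution_scaledSum [DecidableEq ι] (hX : ∀ n, Measurable (X n))
    (hX_indep : iIndepFun X P) (hX_law : ∀ n, P.map (X n) = π)
    (hY : ∀ a, Measurable fun s => Y s a) (hY2 : ∀ a, MemLp (fun s => Y s a) 2 π) :
    TendstoInDistribution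
      (fun n ω => (WithLp.toLp 2 fun a => scaledSum π X (fun s => Y s a) n ω :
        EuclideanSpace ℝ ι)) atTop
      (id : EuclideanSpace ℝ ι → EuclideanSpace ℝ ι) (fun _ => P)
      (multivariateGaussian 0 (varMatrix π Y)) := by
  have hmeas (n : ℕ) : Measurable fun ω =>
      (WithLp.toLp 2 fun a => scaledSum π X (fun s => Y s a) n ω : EuclideanSpace ℝ ι) := by
    refine (WithLp.measurable_toLp 2 _).comp (measurable_pi_lambda _ fun a => ?_)
    exact measurable_scaledSum hX (hY a) n
  refine ⟨fun n => (hmeas n).aemeasurable, aemeasurable_id, ?_⟩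
  refine ProbabilityMeasure.tendsto_iff_tendsto_charFun.2 fun t => ?_
  set φ : S → ℝ := fun s => ∑ a, t a * Y s a with hφ_def
  have hφ : Measurable φ := Finset.measurable_sum _ fun a _ => (hY a).const_mul _
  have hφ2 : MemLp φ 2 π := memLp_finsetSum _ fun a _ => (hY2 a).const_mul _
  have h := ProbabilityMeasure.tendsto_iff_tendsto_charFun.1
    (tendstoInDistribution_scaledSum_real hX hX_indep hX_law hφ hφ2).tendsto 1
  simp only [ProbabilityMeasure.coe_mk, Measure.map_id] at h ⊢
  rw [charFun_gaussianReal] at h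
  rw [charFun_multivariateGaussian (posSemidef_varMatrix hY2)]
  convert h using 2 with n
  · rw [charFun_apply, charFun_apply, integral_map (hmeas n).aemeasurable (by fun_prop),
      integral_map (measurable_scaledSum hX hφ n).aemeasurable (by fun_prop)]
    refine integral_congr_ae (ae_of_all _ fun ω => ?_)
    simp only [hφ_def]
    rw [← sum_mul_scaledSum (fun a => (hY2 a).integrable one_le_two)]
    simp [PiLp.inner_apply]
  · rw [← variance_sum_mul hY2, Real.coe_toNNReal _ (variance_nonneg _ _)]
    simp [hφ_def]

end centralLimit

/-! ### The Bahadur–Ghosh representation -/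

section bahadur

variable {S Ω : Type*} [MeasurableSpace S] [MeasurableSpace Ω]
  {π : Measure S} {P : Measure Ω} {X : ℕ → Ω → S}
  [IsProbabilityMeasure π] [IsProbabilityMeasure P]

lemma measurable_indicator_Ioi {h : S → ℝ} (hh : Measurable h) (v : ℝ) :
    Measurable fun s => (Set.Ioi v).indicator (fun _ => (1 : ℝ)) (h s) :=
  (measurable_const.indicator measurableSet_Ioi).comp hh

lemma memLp_indicator_Ioi {h : S → ℝ} (hh : Measurable h) (v : ℝ) :
    MemLp (fun s => (Set.Ioi v).indicator (fun _ => (1 : ℝ)) (h s)) 2 π := by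
  refine MemLp.of_bound (measurable_indicator_Ioi hh v).aestronglyMeasurable 1
    (ae_of_all _ fun s => ?_)
  by_cases hs : h s ∈ Set.Ioi v <;> simp [Set.indicator, hs]

lemma integral_indicator_Ioi {h : S → ℝ} (hh : Measurable h) (v : ℝ) :
    ∫ s, (Set.Ioi v).indicator (fun _ => (1 : ℝ)) (h s) ∂π = 1 - cdf (π.map h) v := by
  have := Measure.isProbabilityMeasure_map (μ := π) hh.aemeasurable
  rw [← integral_map (f := (Set.Ioi v).indicator fun _ => (1 : ℝ)) hh.aemeasurable
    (measurable_const.indicator measurableSet_Ioi).aestronglyMeasurable,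
    integral_indicator_const _ measurableSet_Ioi, cdf_eq_real, ← Set.compl_Iic,
    probReal_compl_eq_one_sub measurableSet_Iic]
  simp

/-- Up to sign, the difference is the indicator of an interval, hence its own square. -/
lemma integral_sq_indicator_Ioi_sub {h : S → ℝ} (hh : Measurable h) (a b : ℝ) :
    ∫ s, ((Set.Ioi a).indicator (fun _ => (1 : ℝ)) (h s) -
      (Set.Ioi b).indicator (fun _ => (1 : ℝ)) (h s)) ^ 2 ∂π =
      |cdf (π.map h) b - cdf (π.map h) a| := by
  wlog hab : a ≤ b generalizing a b
  · rw [abs_sub_comm, ← this b a (not_le.1 hab).le]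
    exact integral_congr_ae (ae_of_all _ fun s => by ring)
  have hi (v : ℝ) := (memLp_indicator_Ioi (π := π) hh v).integrable one_le_two
  rw [abs_of_nonneg (sub_nonneg.2 (monotone_cdf _ hab))]
  have : ∀ s, ((Set.Ioi a).indicator (fun _ => (1 : ℝ)) (h s) -
      (Set.Ioi b).indicator (fun _ => (1 : ℝ)) (h s)) ^ 2 =
      (Set.Ioi a).indicator (fun _ => (1 : ℝ)) (h s) -
      (Set.Ioi b).indicator (fun _ => (1 : ℝ)) (h s) := by
    intro s
    simp only [Set.indicator_apply, Set.mem_Ioi]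
    split_ifs <;> grind
  simp_rw [this]
  rw [integral_sub (hi a) (hi b), integral_indicator_Ioi hh, integral_indicator_Ioi hh]
  ring

lemma sum_indicator_Ioi_eq (x : ℕ → ℝ) (v : ℝ) (n : ℕ) :
    ∑ j ∈ Finset.range n, (Set.Ioi v).indicator (fun _ => (1 : ℝ)) (x j) =
      n - ((Finset.univ.filter fun j : Fin n => x j ≤ v).card : ℝ) := by
  rw [← Fin.sum_univ_eq_sum_range fun j => (Set.Ioi v).indicator (fun _ => (1 : ℝ)) (x j)]
  rw [eq_sub_iff_add_eq, Finset.card_filter]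
  push_cast
  rw [← Finset.sum_add_distrib]
  have : ∀ j : Fin n, (Set.Ioi v).indicator (fun _ => (1 : ℝ)) (x j) +
      (if x j ≤ v then (1 : ℝ) else 0) = 1 := by
    intro j
    by_cases hj : x j ≤ v
    · simp [hj]
    · simp [hj, not_le.1 hj]
  simp [this]

/-- The Bahadur–Ghosh representation of sample quantiles. -/
lemma tendstoInMeasure_sampleQuantile_sub_scaledSum (hX : ∀ n, Measurable (X n))
    (hX_indep : iIndepFun X P) (hX_law : ∀ n, P.map (X n) = π) {h : S → ℝ} (hh : Measurable h)
    {q ξ d : ℝ} (hq0 : 0 < q) (hq1 : q < 1) (hξ : cdf (π.map h) ξ = q) (hd : 0 < d)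
    (hderiv : HasDerivAt (cdf (π.map h)) d ξ) :
    TendstoInMeasure P (fun (n : ℕ) =>
      (fun ω => √(n : ℝ) * (sampleQuantile q (fun j : Fin n => h (X j ω)) - ξ)) -
        scaledSum π X
          (fun s => d⁻¹ * (Set.Ioi ξ).indicator (fun _ => (1 : ℝ)) (h s)) n) atTop 0 := by
  have hφm (v : ℝ) := (measurable_indicator_Ioi hh v).const_mul d⁻¹
  have hφ2 (v : ℝ) := (memLp_indicator_Ioi (π := π) hh v).const_mul d⁻¹
  refine tendstoInMeasure_sub_of_forall_le_iff (fun δ hδ => ?_) fun y => ?_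
  · set C := ∫ s, (d⁻¹ * (Set.Ioi ξ).indicator (fun _ => (1 : ℝ)) (h s)) ^ 2 ∂π
    have hC : 0 ≤ C := integral_nonneg fun s => sq_nonneg _
    have hM : 0 < √(C / δ) + 1 := by positivity
    refine ⟨√(C / δ) + 1, fun n => ?_⟩
    refine (measureReal_le_abs_scaledSum_le hX hX_indep hX_law (hφm ξ) (hφ2 ξ) hM n).trans ?_
    rw [div_le_iff₀ (by positivity), ← div_le_iff₀' hδ]
    calc C / δ = √(C / δ) ^ 2 := (Real.sq_sqrt (by positivity)).symm
      _ ≤ _ := by gcongr; linarith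
  · set v : ℕ → ℝ := fun n => ξ + (√(n : ℝ))⁻¹ * y with hv_def
    have hsq : Tendsto (fun n : ℕ => √(n : ℝ)) atTop atTop :=
      Real.tendsto_sqrt_atTop.comp tendsto_natCast_atTop_atTop
    have hv : Tendsto v atTop (𝓝 ξ) := by
      have := ((tendsto_inv_atTop_zero.comp hsq).mul_const y).const_add ξ
      simpa using this
    refine ⟨fun n => scaledSum π X
        (fun s => d⁻¹ * (Set.Ioi (v n)).indicator (fun _ => (1 : ℝ)) (h s)) n,
      fun n => d⁻¹ * (√(n : ℝ) * (cdf (π.map h) (v n) - q)), ?_, ?_, ?_⟩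
    -- The difference quotient `√n (F(ξ + y/√n) - F(ξ))` tends to `d y`.
    · have h1 := ((hderiv.hasFDerivAt.lim_real y).comp hsq).const_mul d⁻¹
      simpa [Function.comp_def, hv_def, hξ, mul_comm y, hd.ne'] using h1
    · filter_upwards [eventually_gt_atTop 0] with n hn ω
      have hn' : (0 : ℝ) < n := by exact_mod_cast hn
      have hs : 0 < √(n : ℝ) := Real.sqrt_pos.2 hn'
      have hl : √(n : ℝ) * (sampleQuantile q (fun j : Fin n => h (X j ω)) - ξ) ≤ y ↔
          sampleQuantile q (fun j : Fin n => h (X j ω)) ≤ v n := by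
        rw [← le_div_iff₀' hs, sub_le_iff_le_add', ← inv_mul_eq_div]
      rw [hl, sampleQuantile_le_iff hq0 hq1 hn]
      have hZ : scaledSum π X
          (fun s => d⁻¹ * (Set.Ioi (v n)).indicator (fun _ => (1 : ℝ)) (h s)) n ω =
          d⁻¹ * ((√(n : ℝ))⁻¹ * (n * cdf (π.map h) (v n) -
            ((Finset.univ.filter fun j : Fin n => h (X j ω) ≤ v n).card : ℝ))) := by
        rw [scaledSum, integral_const_mul, integral_indicator_Ioi hh, Finset.sum_sub_distrib,
          ← Finset.mul_sum, sum_indicator_Ioi_eq fun j => h (X j ω)]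
        simp only [Finset.sum_const, Finset.card_range, nsmul_eq_mul]
        ring
      have hu : √(n : ℝ) * (cdf (π.map h) (v n) - q) =
          (√(n : ℝ))⁻¹ * (n * cdf (π.map h) (v n) - n * q) := by
        rw [← mul_sub, ← mul_assoc, inv_mul_eq_div, Real.div_sqrt]
      simp only [hZ, hu]
      -- Both sides contain `n F(v n)`; cancelling it leaves `nq ≤ count`.
      rw [mul_le_mul_iff_right₀ (inv_pos.2 hd), mul_le_mul_iff_right₀ (inv_pos.2 hs),
        sub_le_sub_iff_left]
    · rw [tendstoInMeasure_iff_measureReal_norm]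
      intro ε hε
      have hF : Tendsto (fun n => (d⁻¹ ^ 2 * |cdf (π.map h) (v n) - cdf (π.map h) ξ|) / ε ^ 2)
          atTop (𝓝 0) := by
        have h1 := (hderiv.continuousAt.tendsto.comp hv).sub_const (cdf (π.map h) ξ)
        have h2 := (h1.abs.const_mul (d⁻¹ ^ 2)).div_const (ε ^ 2)
        simpa using h2
      refine squeeze_zero (fun n => measureReal_nonneg) (fun n => ?_) hF
      have hdm := (hφm ξ).sub (hφm (v n))
      have hd2 := (hφ2 ξ).sub (hφ2 (v n))
      have hb := measureReal_le_abs_scaledSum_le hX hX_indep hX_law hdm hd2 hε n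
      have hI : ∫ s, (((fun s => d⁻¹ * (Set.Ioi ξ).indicator (fun _ => (1 : ℝ)) (h s)) -
          fun s => d⁻¹ * (Set.Ioi (v n)).indicator (fun _ => (1 : ℝ)) (h s)) s) ^ 2 ∂π =
          d⁻¹ ^ 2 * |cdf (π.map h) (v n) - cdf (π.map h) ξ| := by
        rw [← integral_sq_indicator_Ioi_sub hh, ← integral_const_mul]
        refine integral_congr_ae (ae_of_all _ fun s => ?_)
        simp only [Pi.sub_apply]
        ring
      rw [hI] at hb
      refine le_trans (le_of_eq ?_) hb
      congr 1
      ext ω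
      simp only [Set.mem_ofPred_eq, Pi.sub_apply, Pi.zero_apply, sub_zero, Real.norm_eq_abs]
      rw [← scaledSum_sub ((hφ2 ξ).integrable one_le_two) ((hφ2 (v n)).integrable one_le_two)]
      rfl

end bahadur

lemma tendstoInMeasure_euclideanSpace {Ω ι : Type*} [MeasurableSpace Ω] {P : Measure Ω}
    [IsProbabilityMeasure P] [Fintype ι] {D : ℕ → Ω → EuclideanSpace ℝ ι}
    (hD : ∀ a, TendstoInMeasure P (fun n ω => D n ω a) atTop 0) :
    TendstoInMeasure P D atTop 0 := by
  rw [tendstoInMeasure_iff_measureReal_norm]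
  intro ε hε
  -- The `+ 1` covers empty `ι` and makes `card ι * η < ε` strict.
  set η := ε / (Fintype.card ι + 1) with hη_def
  have hη : 0 < η := by positivity
  have hsum : Tendsto (fun n => ∑ a, P.real {ω | η ≤ |D n ω a|}) atTop (𝓝 0) := by
    refine Finset.sum_const_zero (ι := ι) (M := ℝ) (s := Finset.univ) ▸
      tendsto_finsetSum _ fun a _ => ?_
    simpa using tendstoInMeasure_iff_measureReal_norm.1 (hD a) η hη
  refine squeeze_zero (fun n => measureReal_nonneg) (fun n => ?_) hsum
  refine (measureReal_mono ?_).trans (measureReal_iUnion_fintype_le fun a => {ω | η ≤ |D n ω a|})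
  intro ω hω
  simp only [Pi.zero_apply, sub_zero, Set.mem_ofPred_eq, Set.mem_iUnion] at hω ⊢
  by_contra! hlt
  have h1 : ‖D n ω‖ ≤ ∑ a, |D n ω a| := by
    rw [EuclideanSpace.norm_eq]
    refine Real.sqrt_le_iff.2 ⟨by positivity, ?_⟩
    simpa using Finset.sum_sq_le_sq_sum_of_nonneg fun a (_ : a ∈ Finset.univ) => abs_nonneg (D n ω a)
  have h2 : ∑ a, |D n ω a| ≤ Fintype.card ι * η := by
    simpa using Finset.sum_le_sum fun a (_ : a ∈ Finset.univ) => (hlt a).le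
  have h3 : (Fintype.card ι + 1) * η = ε := by rw [hη_def]; field_simp
  linarith

end MeanQuantile

/-! ### Joint limit of means and quantiles -/

theorem theorem2
    -- the state space, the target distribution and the functions of interest
    {S : Type*} [MeasurableSpace S] (π : Measure S) [IsProbabilityMeasure π]
    {p₁ p₂ : ℕ}
    (g : S → EuclideanSpace ℝ (Fin p₁)) (hg : Measurable g)
    (h : S → EuclideanSpace ℝ (Fin p₂)) (hh : Measurable h)
    (q : Fin p₂ → ℝ) (hq : ∀ i, 0 < q i ∧ q i < 1)
    -- an IID process from `π`
    {Ω : Type*} [MeasurableSpace Ω] (P : Measure Ω) [IsProbabilityMeasure P]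
    (X : ℕ → Ω → S) (hX : ∀ n, Measurable (X n))
    (hX_indep : iIndepFun X P) (hX_law : ∀ n, P.map (X n) = π)
    -- second moments
    (hg2 : Integrable (fun x => ‖g x‖ ^ 2) π)
    -- `f i` is a density of the distribution of `h i`
    (f : Fin p₂ → ℝ → ℝ) (hf : ∀ i, Measurable (f i)) (hf0 : ∀ i v, 0 ≤ f i v)
    (hf_density : ∀ i,
      π.map (fun x => h x i) = volume.withDensity (fun v => ENNReal.ofReal (f i v)))
    (hf_pos : ∀ i, 0 < f i (quantileVec π h q i))
    (hf_deriv : ∀ i, ∃ C : ℝ, ∀ᶠ v in 𝓝 (quantileVec π h q i),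
      DifferentiableAt ℝ (f i) v ∧ |deriv (f i) v| ≤ C) :
    TendstoInDistribution
      (fun (n : ℕ) (ω : Ω) =>
        √(n : ℝ) • (featuresEstimator g h q (fun j : Fin n => X j ω) - features π g h q))
      atTop
      (id : EuclideanSpace ℝ (Fin p₁ ⊕ Fin p₂) → EuclideanSpace ℝ (Fin p₁ ⊕ Fin p₂))
      (fun _ => P)
      (multivariateGaussian 0
        ((lambdaMatrix p₁ f (quantileVec π h q))⁻¹ *
          varMatrix π (scoreVec g h (quantileVec π h q)) *
          (lambdaMatrix p₁ f (quantileVec π h q))⁻¹)) := by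
  set φ := quantileVec π h q with hφ_def
  set c : Fin p₁ ⊕ Fin p₂ → ℝ := Sum.elim (fun _ => 1) (fun i => (f i (φ i))⁻¹) with hc_def
  -- Absorbing `Λ⁻¹` into the summands makes the target covariance simply `Var(Y)`.
  set Y : S → EuclideanSpace ℝ (Fin p₁ ⊕ Fin p₂) :=
    fun s => WithLp.toLp 2 fun a => c a * scoreVec g h φ s a with hY_def
  have hgi (i : Fin p₁) : Measurable fun s => g s i := by fun_prop
  have hhi (i : Fin p₂) : Measurable fun s => h s i := by fun_prop
  have hscore (a : Fin p₁ ⊕ Fin p₂) : Measurable fun s => scoreVec g h φ s a := by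
    rcases a with i | i
    · exact hgi i
    · exact measurable_indicator_Ioi (hhi i) (φ i)
  have hscore2 (a : Fin p₁ ⊕ Fin p₂) : MemLp (fun s => scoreVec g h φ s a) 2 π := by
    rcases a with i | i
    · have hg' : MemLp g 2 π := (memLp_two_iff_integrable_sq_norm hg.aestronglyMeasurable).2 hg2
      exact hg'.mono (hgi i).aestronglyMeasurable (ae_of_all _ fun s => PiLp.norm_apply_le (g s) i)
    · exact memLp_indicator_Ioi (hhi i) (φ i)
  have hY (a) : Measurable fun s => Y s a := (hscore a).const_mul _
  have hY2 (a) : MemLp (fun s => Y s a) 2 π := (hscore2 a).const_mul _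
  have hcont (i : Fin p₂) : ContinuousAt (f i) (φ i) := by
    obtain ⟨C, hC⟩ := hf_deriv i
    exact hC.self_of_nhds.1.continuousAt
  have hderiv (i : Fin p₂) : HasDerivAt (cdf (π.map fun x => h x i)) (f i (φ i)) (φ i) := by
    have := Measure.isProbabilityMeasure_map (μ := π) (hhi i).aemeasurable
    exact hasDerivAt_cdf (hf i) (hf0 i) (hf_density i) (hcont i)
  have hcov : (lambdaMatrix p₁ f φ)⁻¹ * varMatrix π (scoreVec g h φ) * (lambdaMatrix p₁ f φ)⁻¹ =
      varMatrix π Y := by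
    have hinv : (lambdaMatrix p₁ f φ)⁻¹ = Matrix.diagonal c := by
      refine Matrix.inv_eq_right_inv ?_
      rw [lambdaMatrix, ← Matrix.diagonal_one, Matrix.fromBlocks_diagonal,
        Matrix.diagonal_mul_diagonal, ← Matrix.diagonal_one]
      congr 1
      ext (i | i)
      · simp [hc_def]
      · simp [hc_def, (hf_pos i).ne']
    ext a b
    rw [hinv, Matrix.mul_diagonal, Matrix.diagonal_mul]
    simp only [varMatrix, Matrix.of_apply, hY_def, covariance_const_mul_left,
      covariance_const_mul_right]
    ring
  rw [hcov]
  refine tendstoInDistribution_of_tendstoInMeasure_sub _ _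
    (tendstoInDistribution_scaledSum hX hX_indep hX_law hY hY2) ?_ fun n => ?_
  · refine tendstoInMeasure_euclideanSpace fun a => ?_
    rcases a with i | i
    -- For means the error is identically zero, also at `n = 0`, where both terms vanish.
    · have hzero (n : ℕ) (ω : Ω) : √(n : ℝ) * ((n : ℝ)⁻¹ * ∑ j : Fin n, g (X j ω) i -
          ∫ x, g x i ∂π) - scaledSum π X (fun s => Y s (Sum.inl i)) n ω = 0 := by
        have hYi : (fun s => Y s (Sum.inl i)) = fun s => g s i := by
          ext s
          simp [hY_def, hc_def, scoreVec]
        rw [hYi, scaledSum, ← Fin.sum_univ_eq_sum_range fun j => g (X j ω) i - ∫ x, g x i ∂π,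
          Finset.sum_sub_distrib]
        rcases Nat.eq_zero_or_pos n with rfl | hn
        · simp
        have hs : √(n : ℝ) ≠ 0 := (Real.sqrt_pos.2 (by exact_mod_cast hn)).ne'
        have hn' : (n : ℝ) = √(n : ℝ) * √(n : ℝ) := (Real.mul_self_sqrt n.cast_nonneg).symm
        simp only [Finset.sum_const, Finset.card_univ, Fintype.card_fin, nsmul_eq_mul]
        generalize √(n : ℝ) = r at hs hn'
        rw [hn']
        field_simp
        ring
      have : (fun (n : ℕ) (ω : Ω) => √(n : ℝ) * ((n : ℝ)⁻¹ * ∑ j : Fin n, g (X j ω) i -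
          ∫ x, g x i ∂π) - scaledSum π X (fun s => Y s (Sum.inl i)) n ω) = fun _ _ => 0 := by
        ext n ω
        exact hzero n ω
      change TendstoInMeasure P (fun (n : ℕ) (ω : Ω) => √(n : ℝ) * ((n : ℝ)⁻¹ *
        ∑ j : Fin n, g (X j ω) i - ∫ x, g x i ∂π) -
          scaledSum π X (fun s => Y s (Sum.inl i)) n ω) atTop 0
      rw [this, tendstoInMeasure_iff_measureReal_norm]
      intro ε hε
      simp [not_le.2 hε]
    · exact tendstoInMeasure_sampleQuantile_sub_scaledSum hX hX_indep hX_law (hhi i) (hq i).1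
        (hq i).2 (cdf_quantile (hq i).1 (hq i).2 (hderiv i).continuousAt) (hf_pos i) (hderiv i)
  · suffices hest : Measurable fun ω => featuresEstimator g h q fun j : Fin n => X j ω from
      ((hest.sub_const (features π g h q)).const_smul (√(n : ℝ))).aemeasurable
    refine (WithLp.measurable_toLp 2 _).comp (measurable_pi_lambda _ fun a => ?_)
    rcases a with i | i
    · exact (Finset.measurable_sum Finset.univ fun (j : Fin n) _ =>
        (hgi i).comp (hX j)).const_mul (n : ℝ)⁻¹
    · exact measurable_sampleQuantile (hq i).1 (hq i).2 _ fun j => (hhi i).comp (hX j)
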